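/- For a nonempty compact convex set $K\subset\mathbb R^n$ ($n\ge 1$) and $\sigma>0$, one observes $Y\sim N(\mu,\sigma^2\mathbb I_n)$ with unknown $\mu\in K$. Let $\hat\mu(Y)=\operatorname{argmin}_{\nu\in K}\|Y-\nu\|$ be the least squares estimator (LSE), where $\|\cdot\|$ is the Euclidean norm. Put $$\varepsilon_K(\sigma)^2=\sup_{\mu\in K}\mathbb E_\mu\|\hat\mu(Y)-\mu\|^2,\qquad \varepsilon^{\mathrm{mm}}_K(\sigma)^2=\inf_{\hat\nu}\sup_{\mu\in K}\mathbb E_\mu\|\hat\nu(Y)-\mu\|^2,$$ the infimum being over all measurable estimators $\hat\nu:\mathbb R^n\to\mathbb R^n$. Let $d=\operatorname{diam}(K)$. For $k>0$, the set $K$ is called strongly convex with parameter $k$ if for all $\mu,\nu\in K$ and $\lambda\in[0,1]$ the closed Euclidean ball with centre $\lambda\mu+(1-\lambda)\nu$ and radius $k\lambda(1-\lambda)\|\mu-\nu\|^2$ is contained in $K$. (i) For all $a,b>0$ there is a constant $c>0$, depending only on $a$ and $b$, such that for every $n\ge1$, every $k>0$, every nonempty compact $K\subset\mathbb R^n$ that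 is strongly convex with parameter $k$, and every $\sigma$ with $a(k\sqrt n)^{-1}\le\sigma\le b(k\sqrt n)^{-1}$, $$\varepsilon_K(\sigma)\ge c\,d .$$ (ii) The LSE is suboptimal on $\ell_p$ balls for $p\in(1,2)$. Precisely, let $p\in(1,2)$, $a,b>0$, and let $B_p^n=\{x\in\mathbb R^n:\sum_i|x_i|^p\le1\}$. There is a constant $c>0$, depending only on $p,a,b$, such that for all $n\ge1$ and all $\sigma$ with $a\,n^{-(1-1/p)}\le\sigma\le b\,n^{-(1-1/p)}$, $$c\le\varepsilon_{B_p^n}(\sigma)\le 2 .$$ Moreover, for every $\delta>0$ there is $N$ such that for all $n\ge N$ (with $n \ge 1$) and all $\sigma$ in the same range, $$\varepsilon^{\mathrm{mm}}_{B_p^n}(\sigma)\le\delta\qquad\text{and}\qquad\varepsilon^{\mathrm{mm}}_{B_p^n}(\sigma)\le\delta\,\varepsilon_{B_p^n}(\sigma).$$ -/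

import Mathlib

open MeasureTheory ProbabilityTheory
open scoped ENNReal

/-- `K` is strongly convex with parameter `k`: for all `μ, ν ∈ K` and `t ∈ [0, 1]`, the closed
Euclidean ball of radius `k t (1 - t) ‖μ - ν‖²` around `t μ + (1 - t) ν` is contained in `K`. -/
def IsStronglyConvexSet {n : ℕ} (k : ℝ) (K : Set (EuclideanSpace ℝ (Fin n))) : Prop :=
  ∀ μ ∈ K, ∀ ν ∈ K, ∀ t : ℝ, 0 ≤ t → t ≤ 1 →
    Metric.closedBall (t • μ + (1 - t) • ν) (k * t * (1 - t) * ‖μ - ν‖ ^ 2) ⊆ K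

/-- A strongly convex set with a nonnegative parameter is convex, so convexity need not be assumed
separately. -/
theorem IsStronglyConvexSet.convex {n : ℕ} {k : ℝ} {K : Set (EuclideanSpace ℝ (Fin n))}
    (h : IsStronglyConvexSet k K) (hk : 0 ≤ k) : Convex ℝ K := by
  intro x hx y hy a b ha hb hab
  have hb' : b = 1 - a := by linarith
  subst hb'
  exact h x hx y hy a ha (by linarith) (Metric.mem_closedBall_self (by positivity))

open Classical in
/-- The least squares estimator: the point of `K` that minimizes the Euclidean distance to the
observation `y` (with a placeholder value if no minimizer exists, which does not happen for a
nonempty closed `K`; for convex `K` the minimizer is unique). -/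
noncomputable def lse {n : ℕ} (K : Set (EuclideanSpace ℝ (Fin n)))
    (y : EuclideanSpace ℝ (Fin n)) : EuclideanSpace ℝ (Fin n) :=
  if h : ∃ x ∈ K, ∀ ν ∈ K, ‖y - x‖ ≤ ‖y - ν‖ then h.choose else 0

/-- On a nonempty closed set, the least squares estimator attains the minimum. -/
theorem lse_spec {n : ℕ} {K : Set (EuclideanSpace ℝ (Fin n))} (hK : IsClosed K)
    (hne : K.Nonempty) (y : EuclideanSpace ℝ (Fin n)) :
    lse K y ∈ K ∧ ∀ ν ∈ K, ‖y - lse K y‖ ≤ ‖y - ν‖ := by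
  have h : ∃ x ∈ K, ∀ ν ∈ K, ‖y - x‖ ≤ ‖y - ν‖ := by
    obtain ⟨x, hx, hxy⟩ := hK.exists_infDist_eq_dist hne y
    refine ⟨x, hx, fun ν hν => ?_⟩
    rw [← dist_eq_norm, ← dist_eq_norm, ← hxy]
    exact Metric.infDist_le_dist_of_mem hν
  rw [lse, dif_pos h]
  exact h.choose_spec

/-- The law `N(μ, σ² I)` of the observation `Y = μ + σ Z`, with `Z` standard Gaussian. -/
noncomputable def observationLaw {n : ℕ} (μ : EuclideanSpace ℝ (Fin n)) (σ : ℝ) :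
    Measure (EuclideanSpace ℝ (Fin n)) :=
  (stdGaussian (EuclideanSpace ℝ (Fin n))).map fun z => μ + σ • z

/-- The worst case risk `sup_{μ ∈ K} E ‖f(Y) - μ‖²` over `K` of an estimator `f`,
where `Y ~ N(μ, σ² I)`. -/
noncomputable def worstCaseRisk {n : ℕ} (K : Set (EuclideanSpace ℝ (Fin n))) (σ : ℝ)
    (f : EuclideanSpace ℝ (Fin n) → EuclideanSpace ℝ (Fin n)) : ℝ≥0∞ :=
  ⨆ μ ∈ K, ∫⁻ y, ‖f y - μ‖ₑ ^ 2 ∂(observationLaw μ σ)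

/-- The worst case rate `ε_K(σ)` of the least squares estimator: the square root of its worst case
risk over `K`. -/
noncomputable def lseRate {n : ℕ} (K : Set (EuclideanSpace ℝ (Fin n))) (σ : ℝ) : ℝ≥0∞ :=
  worstCaseRisk K σ (lse K) ^ (1 / 2 : ℝ)

/-- The minimax rate: the square root of the infimum, over all measurable estimators, of the worst
case risk over `K`. -/
noncomputable def minimaxRate {n : ℕ} (K : Set (EuclideanSpace ℝ (Fin n))) (σ : ℝ) : ℝ≥0∞ :=
  (⨅ (f : EuclideanSpace ℝ (Fin n) → EuclideanSpace ℝ (Fin n)) (_ : Measurable f),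
    worstCaseRisk K σ f) ^ (1 / 2 : ℝ)

/-- The closed unit `ℓ_p` ball of `ℝⁿ` (for `0 < p < ∞`). -/
def lpUnitBall (n : ℕ) (p : ℝ) : Set (EuclideanSpace ℝ (Fin n)) :=
  {x | ∑ i, |x i| ^ p ≤ 1}

/-! Lower bound. Strong convexity adds a gain `k ‖p - v‖² ‖y - p‖` to the variational inequality of
the projection `p` of `y` (`IsStronglyConvexSet.le_inner_sub_lse`). Take the end points `ξ, η` of a
diameter and add the same noise `w` to both, with projections `p, q`. The two inequalities sum to
`‖p - q‖ (1 + k (N₁ + N₂)) ≤ d`, where `N₁, N₂` are the residual lengths. If both errors were small,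
the residuals would have length about `‖w‖ ≈ σ √n ≳ 1 / k`, so `p` and `q` would be closer than `d`
by a constant fraction; but small errors keep them nearly `d` apart. Hence the errors add up to a
multiple of `d` (`two_point_gap`), and averaging over `w` bounds the worst case risk.

On `ℓ_p` balls, `k` is of order `n ^ (-(1 / p - 1 / 2))` (`isStronglyConvexSet_lpUnitBall`), so `(k
√n)⁻¹` is of order `n ^ (-(1 - 1 / p))`, and the diameter is at least 2. At this noise level hard
thresholding at a small fixed level already has vanishing risk: its bias is controlled by the level
and its noise term by a high Gaussian moment (`sq_hardThreshold_sub_le`). -/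

/-! ### Projections on convex and strongly convex sets. -/

/-- The variational inequality that characterizes the projection on a convex set. -/
theorem inner_sub_lse_nonpos {n : ℕ} {K : Set (EuclideanSpace ℝ (Fin n))} (hK : IsClosed K)
    (hne : K.Nonempty) (hc : Convex ℝ K) (y : EuclideanSpace ℝ (Fin n))
    {v : EuclideanSpace ℝ (Fin n)} (hv : v ∈ K) :
    inner ℝ (y - lse K y) (v - lse K y) ≤ 0 := by
  obtain ⟨hmem, hmin⟩ := lse_spec hK hne y
  refine (norm_eq_iInf_iff_real_inner_le_zero hc hmem).1 ?_ v hv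
  have : Nonempty K := ⟨⟨_, hmem⟩⟩
  refine le_antisymm (le_ciInf fun w => hmin w w.2) ?_
  exact ciInf_le (f := fun w : K => ‖y - w‖) ⟨0, by rintro _ ⟨w, rfl⟩; exact norm_nonneg _⟩
    ⟨_, hmem⟩

theorem lipschitzWith_lse {n : ℕ} {K : Set (EuclideanSpace ℝ (Fin n))} (hK : IsClosed K)
    (hne : K.Nonempty) (hc : Convex ℝ K) : LipschitzWith 1 (lse K) := by
  refine LipschitzWith.of_dist_le_mul fun x y => ?_
  rw [NNReal.coe_one, one_mul, dist_eq_norm, dist_eq_norm]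
  have h1 := inner_sub_lse_nonpos hK hne hc x (lse_spec hK hne y).1
  have h2 := inner_sub_lse_nonpos hK hne hc y (lse_spec hK hne x).1
  set p := lse K x
  set q := lse K y
  have h3 : ‖p - q‖ ^ 2 ≤ inner ℝ (x - y) (p - q) := by
    rw [← real_inner_self_eq_norm_sq]
    have e1 : inner ℝ (x - p) (q - p) = - inner ℝ (x - p) (p - q) := by
      rw [← inner_neg_right, neg_sub]
    have e2 : inner ℝ (x - y) (p - q)
        = inner ℝ (x - p) (p - q) + inner ℝ (p - q) (p - q) - inner ℝ (y - q) (p - q) := by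
      rw [← inner_add_left, ← inner_sub_left]; congr 1; abel
    linarith
  have h4 := real_inner_le_norm (x - y) (p - q)
  by_contra! h
  nlinarith [norm_nonneg (p - q), norm_nonneg (x - y)]

/-- On a strongly convex set, the variational inequality of the projection has a quadratic gain. -/
theorem IsStronglyConvexSet.le_inner_sub_lse {n : ℕ} {k : ℝ}
    {K : Set (EuclideanSpace ℝ (Fin n))} (h : IsStronglyConvexSet k K) (hk : 0 ≤ k)
    (hK : IsClosed K) (hne : K.Nonempty) (y : EuclideanSpace ℝ (Fin n))
    {v : EuclideanSpace ℝ (Fin n)} (hv : v ∈ K) :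
    k * ‖lse K y - v‖ ^ 2 * ‖y - lse K y‖ ≤ inner ℝ (y - lse K y) (lse K y - v) := by
  have hp := (lse_spec hK hne y).1
  have hvar := fun w hw => inner_sub_lse_nonpos hK hne (h.convex hk) y (v := w) hw
  set p := lse K y
  -- The variational inequality is tested on `t p + (1 - t) v`, pushed along the residual by the
  -- full ball radius. Dividing by `1 - t` and letting `t → 1` gives the gain.
  have key : ∀ t : ℝ, 0 ≤ t → t < 1 →
      k * t * ‖p - v‖ ^ 2 * ‖y - p‖ ≤ inner ℝ (y - p) (p - v) := by
    intro t ht ht1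
    -- If `y = p` then `u = 0`, hence only `‖u‖ ≤ 1`.
    set u : EuclideanSpace ℝ (Fin n) := ‖y - p‖⁻¹ • (y - p) with hu
    have hu1 : ‖u‖ ≤ 1 := by
      rw [hu, norm_smul, norm_inv, norm_norm]
      exact inv_mul_le_one
    have hyu : inner ℝ (y - p) u = ‖y - p‖ := by
      rw [hu, inner_smul_right, real_inner_self_eq_norm_sq]
      rcases eq_or_ne ‖y - p‖ 0 with h0 | h0
      · simp [h0]
      · field_simp
    set r := k * t * (1 - t) * ‖p - v‖ ^ 2 with hr
    have hr0 : 0 ≤ r := by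
      have : 0 ≤ 1 - t := by linarith
      positivity
    have hw : t • p + (1 - t) • v + r • u ∈ K := by
      refine h p hp v hv t ht ht1.le ?_
      rw [Metric.mem_closedBall, dist_eq_norm, add_sub_cancel_left, norm_smul, Real.norm_eq_abs,
        abs_of_nonneg hr0]
      exact mul_le_of_le_one_right hr0 hu1
    have h1 := hvar _ hw
    have e : t • p + (1 - t) • v + r • u - p = r • u - (1 - t) • (p - v) := by
      module
    rw [e, inner_sub_right, inner_smul_right _ _ (1 - t),
      inner_smul_right _ u, hyu, hr] at h1
    have h2 : (1 - t) * (k * t * ‖p - v‖ ^ 2 * ‖y - p‖) ≤ (1 - t) * inner ℝ (y - p) (p - v) := by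
      linarith
    exact le_of_mul_le_mul_left h2 (by linarith)
  have hlim : Filter.Tendsto (fun t : ℝ => k * t * ‖p - v‖ ^ 2 * ‖y - p‖)
      (nhdsWithin 1 (Set.Iio 1)) (nhds (k * 1 * ‖p - v‖ ^ 2 * ‖y - p‖)) := by
    refine Filter.Tendsto.mono_left ?_ nhdsWithin_le_nhds
    exact Continuous.tendsto (by fun_prop) 1
  rw [mul_one] at hlim
  refine le_of_tendsto hlim ?_
  filter_upwards [Ico_mem_nhdsLT (zero_lt_one (α := ℝ))] with t ht
  exact key t ht.1 ht.2

/-! ### The two-point argument at the ends of a diameter. -/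

/-- The diameter of a bounded strongly convex set with parameter `k`, if attained, is at most `2 / k`. -/
theorem IsStronglyConvexSet.mul_diam_le_two {n : ℕ} {k : ℝ}
    {K : Set (EuclideanSpace ℝ (Fin n))} (h : IsStronglyConvexSet k K) (hk : 0 < k)
    (hb : Bornology.IsBounded K) {ξ η : EuclideanSpace ℝ (Fin n)} (hξ : ξ ∈ K) (hη : η ∈ K)
    (hd : ‖ξ - η‖ = Metric.diam K) : k * ‖ξ - η‖ ≤ 2 := by
  rcases eq_or_lt_of_le (norm_nonneg (ξ - η)) with h0 | h0
  · rw [← h0]; norm_num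
  set d := ‖ξ - η‖
  set r := k * (1 / 2) * (1 - 1 / 2) * d ^ 2 with hr
  set u := d⁻¹ • (ξ - η)
  have hu : ‖u‖ = 1 := by
    rw [norm_smul, norm_inv, norm_norm]; exact inv_mul_cancel₀ h0.ne'
  have hr0 : 0 ≤ r := by rw [hr]; norm_num; positivity
  -- The ball at the midpoint has a diameter of length `k d² / 2`, which cannot exceed `d`.
  have hball := h ξ hξ η hη (1 / 2) (by norm_num) (by norm_num)
  set m := (1 / 2 : ℝ) • ξ + (1 - 1 / 2 : ℝ) • η
  have h1 : m + r • u ∈ K := hball (by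
    rw [Metric.mem_closedBall, dist_eq_norm, add_sub_cancel_left, norm_smul, hu, mul_one,
      Real.norm_eq_abs, abs_of_nonneg hr0])
  have h2 : m - r • u ∈ K := hball (by
    rw [Metric.mem_closedBall, dist_eq_norm, sub_sub_cancel_left, norm_neg, norm_smul, hu, mul_one,
      Real.norm_eq_abs, abs_of_nonneg hr0])
  have h3 := Metric.dist_le_diam_of_mem hb h1 h2
  have e : m + r • u - (m - r • u) = (2 * r) • u := by module
  rw [dist_eq_norm, e, norm_smul, hu, mul_one, Real.norm_eq_abs, abs_of_nonneg (by linarith),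
    ← hd, hr] at h3
  by_contra! hcon
  nlinarith

/-- Here `P = ‖p - q‖`, `e, f` are the errors and `s = ‖w‖`. With `c = a / (3 + 2 a)`, an error sum
below `c d T` forces `P > d (1 - c T)` and `k (N₁ + N₂) ≥ 2 (a - c) T`, so `hmain` fails once `(1 -
c T) (1 + 2 (a - c) T) > 1`. -/
theorem two_point_gap {a k d e f s P N₁ N₂ T : ℝ} (ha : 0 < a) (hk : 0 < k)
    (he : 0 ≤ e) (hf : 0 ≤ f) (hT : 0 ≤ T) (hT1 : T ≤ 1) (hP : d - (e + f) ≤ P)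
    (hN₁ : s - e ≤ N₁) (hN₂ : s - f ≤ N₂) (hs : a * T ≤ k * s) (hkd : k * d ≤ 2) (hd : 0 ≤ d)
    (hmain : P ^ 2 + k * P ^ 2 * (N₁ + N₂) ≤ d * P) :
    a / (3 + 2 * a) * d * T ≤ e + f := by
  set c := a / (3 + 2 * a) with hc
  have hc0 : 0 < c := by positivity
  have hce : c * (3 + 2 * a) = a := by rw [hc]; field_simp
  have hc1 : c < 1 / 2 := by rw [hc, div_lt_iff₀ (by positivity)]; linarith
  by_contra! hlt
  have hpos : 0 < c * d * T := by linarith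
  have hTpos : 0 < T := by
    rcases hT.eq_or_lt with h | h
    · rw [← h] at hpos; simp at hpos
    · exact h
  have hdpos : 0 < d := by
    rcases hd.eq_or_lt with h | h
    · rw [← h] at hpos; simp at hpos
    · exact h
  have hcT : c * T ≤ c := mul_le_of_le_one_right hc0.le hT1
  have hP1 : d * (1 - c * T) < P := by nlinarith
  have hPpos : 0 < P := lt_trans (by apply mul_pos hdpos; linarith) hP1
  have h1 : P * (1 + k * (N₁ + N₂)) ≤ d := by
    refine le_of_mul_le_mul_left ?_ hPpos
    nlinarith
  have h2 : k * (e + f) ≤ 2 * (c * T) := by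
    have : k * (e + f) ≤ k * (c * d * T) := mul_le_mul_of_nonneg_left hlt.le hk.le
    nlinarith [mul_nonneg hc0.le hT]
  have h3 : 2 * (a * T) - 2 * (c * T) ≤ k * (N₁ + N₂) := by nlinarith
  have hca : c ≤ a := by nlinarith
  have h4 : 1 < (1 - c * T) * (1 + (2 * (a * T) - 2 * (c * T))) := by
    have hA : a * T * (1 - T) ≥ 0 := by
      apply mul_nonneg (by positivity); linarith
    have : (1 - c * T) * (1 + (2 * (a * T) - 2 * (c * T))) - 1
        = T * (2 * a - 3 * c - 2 * a * c * T + 2 * c ^ 2 * T) := by ring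
    -- The choice of `c` makes `2 a - c (3 + 2 a) = a > 0`.
    have h5 : 0 < 2 * a - 3 * c - 2 * a * c * T + 2 * c ^ 2 * T := by
      have : a * c * T ≤ a * c := mul_le_of_le_one_right (by positivity) hT1
      have : 0 ≤ c ^ 2 * T := by positivity
      nlinarith
    have := mul_pos hTpos h5
    linarith
  have h6 : 0 < 1 + (2 * (a * T) - 2 * (c * T)) := by nlinarith
  have h7 : P * (1 + (2 * (a * T) - 2 * (c * T))) ≤ d :=
    le_trans (mul_le_mul_of_nonneg_left (by linarith) hPpos.le) h1
  have h8 : d * (1 - c * T) * (1 + (2 * (a * T) - 2 * (c * T))) < d :=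
    lt_of_lt_of_le (mul_lt_mul_of_pos_right hP1 h6) h7
  nlinarith

/-- If the noise is large, then the least squares estimator errs at one of the two end points of a
diameter. -/
theorem IsStronglyConvexSet.lse_error_add_lse_error_ge {n : ℕ} {a k T : ℝ}
    {K : Set (EuclideanSpace ℝ (Fin n))} (h : IsStronglyConvexSet k K) (ha : 0 < a) (hk : 0 < k)
    (hK : IsCompact K) {ξ η : EuclideanSpace ℝ (Fin n)} (hξ : ξ ∈ K) (hη : η ∈ K)
    (hd : ‖ξ - η‖ = Metric.diam K) (w : EuclideanSpace ℝ (Fin n)) (hT : 0 ≤ T) (hT1 : T ≤ 1)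
    (hw : a * T ≤ k * ‖w‖) :
    a / (3 + 2 * a) * Metric.diam K * T ≤ ‖lse K (ξ + w) - ξ‖ + ‖lse K (η + w) - η‖ := by
  have hne : K.Nonempty := ⟨ξ, hξ⟩
  have h1 := h.le_inner_sub_lse hk.le hK.isClosed hne (ξ + w)
    (lse_spec hK.isClosed hne (η + w)).1
  have h2 := h.le_inner_sub_lse hk.le hK.isClosed hne (η + w)
    (lse_spec hK.isClosed hne (ξ + w)).1
  have hkd := h.mul_diam_le_two hk hK.isBounded hξ hη hd
  rw [← hd]
  set p := lse K (ξ + w)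
  set q := lse K (η + w)
  refine two_point_gap (P := ‖p - q‖) (N₁ := ‖ξ + w - p‖) (N₂ := ‖η + w - q‖) ha hk
    (norm_nonneg _) (norm_nonneg _) hT hT1 ?_ ?_ ?_ hw hkd (norm_nonneg _) ?_
  · have : ξ - η = -(p - ξ) + (p - q) + (q - η) := by abel
    have h3 := norm_add₃_le (a := -(p - ξ)) (b := p - q) (c := q - η)
    rw [← this, norm_neg] at h3
    linarith
  · have : w = (ξ + w - p) + (p - ξ) := by abel
    have h3 := norm_add_le (ξ + w - p) (p - ξ)
    rw [← this] at h3
    linarith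
  · have : w = (η + w - q) + (q - η) := by abel
    have h3 := norm_add_le (η + w - q) (q - η)
    rw [← this] at h3
    linarith
  · have e1 : inner ℝ (η + w - q) (q - p) = - inner ℝ (η + w - q) (p - q) := by
      rw [← inner_neg_right, neg_sub]
    have e2 : inner ℝ (ξ - η) (p - q)
        = inner ℝ (ξ + w - p) (p - q) + inner ℝ (p - q) (p - q) - inner ℝ (η + w - q) (p - q) := by
      rw [← inner_add_left, ← inner_sub_left]; congr 1; abel
    have h4 := real_inner_le_norm (ξ - η) (p - q)
    rw [real_inner_self_eq_norm_sq] at e2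
    rw [norm_sub_rev q p] at h2
    linarith

/-! ### Geometry of `ℓ_p` balls. -/

/-- For `1 < p < 2` the function `|t| ^ p` is strongly convex on `[-1, 1]`. -/
theorem convexOn_abs_rpow_sub_sq {p : ℝ} (hp : 1 < p) (hp2 : p < 2) :
    ConvexOn ℝ (Set.Icc (-1) 1) fun t : ℝ => |t| ^ p - p * (p - 1) / 2 * t ^ 2 := by
  have hhalf : ConvexOn ℝ (Set.Icc (0 : ℝ) 1) fun t : ℝ => t ^ p - p * (p - 1) / 2 * t ^ 2 := by
    refine convexOn_of_hasDerivWithinAt2_nonneg (f' := fun t => p * t ^ (p - 1) - p * (p - 1) * t)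
      (f'' := fun t => p * ((p - 1) * t ^ (p - 1 - 1)) - p * (p - 1)) (convex_Icc 0 1) ?_ ?_ ?_ ?_
    · refine ContinuousOn.sub (ContinuousOn.rpow_const continuousOn_id ?_) (by fun_prop)
      intro x _; right; linarith
    · intro x hx
      rw [interior_Icc] at hx
      have h1 := Real.hasDerivAt_rpow_const (x := x) (p := p) (Or.inl hx.1.ne')
      have h2 := ((hasDerivAt_pow 2 x).const_mul (p * (p - 1) / 2))
      refine (h1.sub h2).hasDerivWithinAt.congr_deriv ?_
      norm_num; ring
    · intro x hx
      rw [interior_Icc] at hx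
      have h1 := (Real.hasDerivAt_rpow_const (x := x) (p := p - 1) (Or.inl hx.1.ne')).const_mul p
      have h2 := ((hasDerivAt_id x).const_mul (p * (p - 1)))
      refine (h1.sub h2).hasDerivWithinAt.congr_deriv ?_
      norm_num
    · intro x hx
      rw [interior_Icc] at hx
      have : 1 ≤ x ^ (p - 1 - 1) :=
        Real.one_le_rpow_of_pos_of_le_one_of_nonpos hx.1 hx.2.le (by linarith)
      have h3 : 0 < p * (p - 1) := by apply mul_pos <;> linarith
      nlinarith
  -- Monotonicity lets convexity on `[0, 1]` survive composition with `|·|`.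
  have hmono : MonotoneOn (fun t : ℝ => t ^ p - p * (p - 1) / 2 * t ^ 2) (Set.Icc (0 : ℝ) 1) := by
    refine monotoneOn_of_hasDerivWithinAt_nonneg
      (f' := fun t => p * t ^ (p - 1) - p * (p - 1) * t) (convex_Icc 0 1) ?_ ?_ ?_
    · refine ContinuousOn.sub (ContinuousOn.rpow_const continuousOn_id ?_) (by fun_prop)
      intro x _; right; linarith
    · intro x hx
      rw [interior_Icc] at hx
      have h1 := Real.hasDerivAt_rpow_const (x := x) (p := p) (Or.inl hx.1.ne')
      have h2 := ((hasDerivAt_pow 2 x).const_mul (p * (p - 1) / 2))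
      refine (h1.sub h2).hasDerivWithinAt.congr_deriv ?_
      norm_num; ring
    · intro x hx
      rw [interior_Icc] at hx
      have h1 : x ≤ x ^ (p - 1) := by
        simpa using Real.rpow_le_rpow_of_exponent_ge hx.1 hx.2.le (show p - 1 ≤ 1 by linarith)
      have h2 : (p - 1) * x ≤ x := by nlinarith [hx.1]
      nlinarith
  have himg : (fun t : ℝ => |t|) '' Set.Icc (-1 : ℝ) 1 ⊆ Set.Icc 0 1 := by
    rintro _ ⟨x, hx, rfl⟩
    exact ⟨abs_nonneg x, abs_le.2 hx⟩
  refine ⟨convex_Icc _ _, ?_⟩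
  intro x hx y hy α β hα hβ hαβ
  have hx' : |x| ∈ Set.Icc (0 : ℝ) 1 := ⟨abs_nonneg x, abs_le.2 hx⟩
  have hy' : |y| ∈ Set.Icc (0 : ℝ) 1 := ⟨abs_nonneg y, abs_le.2 hy⟩
  have h1 := hhalf.2 hx' hy' hα hβ hαβ
  have h2 : |α • x + β • y| ≤ α • |x| + β • |y| := by
    simp only [smul_eq_mul]
    calc |α * x + β * y| ≤ |α * x| + |β * y| := abs_add_le _ _
      _ = α * |x| + β * |y| := by rw [abs_mul, abs_mul, abs_of_nonneg hα, abs_of_nonneg hβ]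
  have h3 := (convex_Icc (0 : ℝ) 1) hx' hy' hα hβ hαβ
  have h4 := hmono ⟨abs_nonneg _, h2.trans h3.2⟩ h3 h2
  have h5 := h4.trans h1
  simpa only [sq_abs] using h5

theorem abs_rpow_convexCombo_le {p : ℝ} (hp : 1 < p) (hp2 : p < 2) {x y t : ℝ} (hx : |x| ≤ 1)
    (hy : |y| ≤ 1) (ht : 0 ≤ t) (ht1 : t ≤ 1) :
    |t * x + (1 - t) * y| ^ p ≤
      t * |x| ^ p + (1 - t) * |y| ^ p - p * (p - 1) / 2 * (t * (1 - t)) * (x - y) ^ 2 := by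
  have h := (convexOn_abs_rpow_sub_sq hp hp2).2 (abs_le.1 hx) (abs_le.1 hy) ht
    (sub_nonneg.2 ht1) (by ring)
  simp only [smul_eq_mul] at h
  linarith

theorem abs_le_one_of_mem_lpUnitBall {n : ℕ} {p : ℝ} (hp : 0 < p)
    {x : EuclideanSpace ℝ (Fin n)} (hx : x ∈ lpUnitBall n p) (i : Fin n) : |x i| ≤ 1 := by
  have h1 : |x i| ^ p ≤ 1 := le_trans
    (Finset.single_le_sum (f := fun i => |x i| ^ p) (fun j _ => by positivity)
      (Finset.mem_univ i)) hx
  by_contra! h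
  exact absurd (Real.one_lt_rpow h hp) (not_lt.2 h1)

theorem norm_le_one_of_mem_lpUnitBall {n : ℕ} {p : ℝ} (hp : 0 < p) (hp2 : p ≤ 2)
    {x : EuclideanSpace ℝ (Fin n)} (hx : x ∈ lpUnitBall n p) : ‖x‖ ≤ 1 := by
  rw [← sq_le_one_iff₀ (norm_nonneg _), EuclideanSpace.norm_sq_eq]
  refine le_trans (Finset.sum_le_sum fun i _ => ?_) hx
  have h1 := abs_le_one_of_mem_lpUnitBall hp hx i
  rw [Real.norm_eq_abs, ← Real.rpow_two]
  rcases (abs_nonneg (x i)).eq_or_lt with h0 | h0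
  · rw [← h0, Real.zero_rpow hp.ne', Real.zero_rpow (by norm_num)]
  · exact Real.rpow_le_rpow_of_exponent_ge h0 h1 hp2

theorem isCompact_lpUnitBall {n : ℕ} {p : ℝ} (hp : 0 < p) (hp2 : p ≤ 2) :
    IsCompact (lpUnitBall n p) := by
  refine Metric.isCompact_of_isClosed_isBounded ?_ ?_
  · refine isClosed_le ?_ continuous_const
    refine continuous_finsetSum _ fun i _ => ?_
    exact Continuous.rpow_const (by fun_prop) fun x => Or.inr hp.le
  · refine (Metric.isBounded_closedBall (x := (0 : EuclideanSpace ℝ (Fin n))) (r := 1)).subset ?_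
    intro x hx
    simpa using norm_le_one_of_mem_lpUnitBall hp hp2 hx

theorem zero_mem_lpUnitBall {n : ℕ} {p : ℝ} (hp : 0 < p) :
    (0 : EuclideanSpace ℝ (Fin n)) ∈ lpUnitBall n p := by
  simp [lpUnitBall, Real.zero_rpow hp.ne']

theorem single_mem_lpUnitBall {n : ℕ} {p : ℝ} (hp : 0 < p) (i : Fin n) {s : ℝ} (hs : |s| ≤ 1) :
    EuclideanSpace.single i s ∈ lpUnitBall n p := by
  rw [lpUnitBall, Set.mem_ofPred_eq, Finset.sum_eq_single i]
  · simpa using Real.rpow_le_one (abs_nonneg s) hs hp.le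
  · intro j _ hj
    simp [hj, Real.zero_rpow hp.ne']
  · simp

theorem two_le_diam_lpUnitBall {n : ℕ} {p : ℝ} (hn : 1 ≤ n) (hp : 0 < p) (hp2 : p ≤ 2) :
    2 ≤ Metric.diam (lpUnitBall n p) := by
  set i : Fin n := ⟨0, hn⟩
  have h := Metric.dist_le_diam_of_mem (isCompact_lpUnitBall hp hp2).isBounded
    (single_mem_lpUnitBall hp i (s := 1) (by simp)) (single_mem_lpUnitBall hp i (s := -1) (by simp))
  rw [PiLp.dist_single_same, Real.dist_eq] at h
  norm_num at h
  exact h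

/-- Comparison of the `ℓ_p` norm with the Euclidean norm. -/
theorem sum_abs_rpow_rpow_le {n : ℕ} {p : ℝ} (hp : 1 ≤ p) (hp2 : p < 2)
    (u : EuclideanSpace ℝ (Fin n)) :
    (∑ i, |u i| ^ p) ^ (1 / p) ≤ (n : ℝ) ^ (1 / p - 1 / 2) * ‖u‖ := by
  have hp0 : 0 < p := by linarith
  have hconj : (2 / (2 - p)).HolderConjugate (2 / p) := by
    rw [Real.holderConjugate_iff]
    refine ⟨by rw [lt_div_iff₀] <;> linarith, ?_⟩
    have : 2 - p ≠ 0 := by linarith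
    field_simp; ring
  have h := Real.inner_le_Lp_mul_Lq_of_nonneg Finset.univ (f := fun _ : Fin n => (1 : ℝ))
    (g := fun i => |u i| ^ p) hconj (fun _ _ => zero_le_one) (fun i _ => by positivity)
  simp only [one_mul, Real.one_rpow, Finset.sum_const, Finset.card_univ, Fintype.card_fin,
    nsmul_eq_mul, mul_one, one_div_div] at h
  have e : ∀ i, (|u i| ^ p) ^ (2 / p) = ‖u i‖ ^ 2 := by
    intro i
    rw [← Real.rpow_mul (abs_nonneg _), mul_div_cancel₀ _ hp0.ne', Real.rpow_two, Real.norm_eq_abs]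
  simp only [e] at h
  rw [← EuclideanSpace.norm_sq_eq] at h
  calc (∑ i, |u i| ^ p) ^ (1 / p)
      ≤ ((n : ℝ) ^ ((2 - p) / 2) * (‖u‖ ^ 2) ^ (p / 2)) ^ (1 / p) :=
        Real.rpow_le_rpow (Finset.sum_nonneg fun i _ => by positivity) h (by positivity)
    _ = (n : ℝ) ^ (1 / p - 1 / 2) * ‖u‖ := by
        rw [Real.mul_rpow (by positivity) (by positivity), ← Real.rpow_mul (by positivity),
          ← Real.rpow_two, ← Real.rpow_mul (norm_nonneg _), ← Real.rpow_mul (norm_nonneg _)]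
        congr 1
        · congr 1; field_simp
        · rw [show (2 : ℝ) * (p / 2) * (1 / p) = 1 by field_simp, Real.rpow_one]

/-- Summing the scalar strong convexity gives `∑ |m i| ^ p ≤ 1 - p s`, and Bernoulli's inequality
turns this into an `ℓ_p` norm of at most `1 - s`. The parameter is such that the Euclidean ball
around `m` has `ℓ_p` radius at most `s`; Minkowski concludes. -/
theorem isStronglyConvexSet_lpUnitBall {n : ℕ} {p : ℝ} (hn : 1 ≤ n) (hp : 1 < p) (hp2 : p < 2) :
    IsStronglyConvexSet ((p - 1) / 2 * (n : ℝ) ^ (-(1 / p - 1 / 2))) (lpUnitBall n p) := by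
  have hp0 : 0 < p := by linarith
  have hnpos : (0 : ℝ) < n := by exact_mod_cast hn
  intro x hx y hy t ht ht1 z hz
  set m := t • x + (1 - t) • y with hm
  rw [Metric.mem_closedBall, dist_eq_norm] at hz
  set s := (p - 1) / 2 * (t * (1 - t)) * ‖x - y‖ ^ 2 with hs
  have hs0 : 0 ≤ s := by
    have h1 : 0 ≤ 1 - t := by linarith
    have h2 : 0 < p - 1 := by linarith
    positivity
  have hmsum : ∑ i, |m i| ^ p ≤ 1 - p * s := by
    have h1 : ∀ i, |m i| ^ p ≤ t * |x i| ^ p + (1 - t) * |y i| ^ p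
        - p * (p - 1) / 2 * (t * (1 - t)) * (x i - y i) ^ 2 := fun i => by
      simpa [hm] using abs_rpow_convexCombo_le hp hp2 (abs_le_one_of_mem_lpUnitBall hp0 hx i)
        (abs_le_one_of_mem_lpUnitBall hp0 hy i) ht ht1
    have h2 := Finset.sum_le_sum fun i (_ : i ∈ Finset.univ) => h1 i
    rw [Finset.sum_sub_distrib, Finset.sum_add_distrib, ← Finset.mul_sum, ← Finset.mul_sum,
      ← Finset.mul_sum] at h2
    have h3 : ∑ i, (x i - y i) ^ 2 = ‖x - y‖ ^ 2 := by
      rw [EuclideanSpace.norm_sq_eq]; simp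
    rw [h3] at h2
    have hx1 : ∑ i, |x i| ^ p ≤ 1 := hx
    have hy1 : ∑ i, |y i| ^ p ≤ 1 := hy
    have h4 : t * ∑ i, |x i| ^ p ≤ t * 1 := mul_le_mul_of_nonneg_left hx1 ht
    have h5 : (1 - t) * ∑ i, |y i| ^ p ≤ (1 - t) * 1 :=
      mul_le_mul_of_nonneg_left hy1 (by linarith)
    rw [hs]; linarith
  have hsum0 : 0 ≤ ∑ i, |m i| ^ p := Finset.sum_nonneg fun i _ => by positivity
  have hmp : (∑ i, |m i| ^ p) ^ (1 / p) ≤ 1 - s := by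
    have hb : 1 + p * (-s) ≤ (1 + (-s)) ^ p :=
      one_add_mul_self_le_rpow_one_add (by nlinarith) hp.le
    have hs1 : 0 ≤ 1 - s := by nlinarith
    calc (∑ i, |m i| ^ p) ^ (1 / p) ≤ ((1 - s) ^ p) ^ (1 / p) := by
          apply Real.rpow_le_rpow hsum0 _ (by positivity)
          rw [sub_eq_add_neg]; linarith
      _ = 1 - s := by
          rw [← Real.rpow_mul hs1, mul_one_div_cancel hp0.ne', Real.rpow_one]
  have hup : (∑ i, |(z - m) i| ^ p) ^ (1 / p) ≤ s := by
    refine (sum_abs_rpow_rpow_le hp.le hp2 (z - m)).trans ?_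
    have hN : (0 : ℝ) < (n : ℝ) ^ (1 / p - 1 / 2) := Real.rpow_pos_of_pos hnpos _
    refine (mul_le_mul_of_nonneg_left hz hN.le).trans_eq ?_
    rw [Real.rpow_neg hnpos.le, hs]
    field_simp
  have hmink := Real.Lp_add_le Finset.univ (fun i => m i) (fun i => (z - m) i) hp.le
  have e : ∀ i, m i + (z - m) i = z i := fun i => by simp
  simp only [e] at hmink
  have h1 : (∑ i, |z i| ^ p) ^ (1 / p) ≤ 1 := by linarith
  by_contra hcon
  have h2 : 1 < ∑ i, |z i| ^ p := not_le.1 hcon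
  exact absurd (Real.one_lt_rpow h2 (show 0 < 1 / p by positivity)) (not_lt.2 h1)

/-! ### Gaussian averaging and the lower bound for the least squares rate. -/

theorem measurePreserving_eval_stdGaussian {n : ℕ} (i : Fin n) :
    MeasurePreserving (fun z : EuclideanSpace ℝ (Fin n) => z i)
      (stdGaussian (EuclideanSpace ℝ (Fin n))) (gaussianReal 0 1) := by
  have h := measurePreserving_eval_multivariateGaussian (μ := (0 : EuclideanSpace ℝ (Fin n)))
    (S := 1) Matrix.PosSemidef.one (i := i)
  simpa [multivariateGaussian_zero_one] using h

theorem lintegral_stdGaussian_sum_eval {n : ℕ} {g : ℝ → ℝ≥0∞} (hg : Measurable g) :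
    ∫⁻ z, ∑ i, g (z i) ∂(stdGaussian (EuclideanSpace ℝ (Fin n)))
      = n * ∫⁻ x, g x ∂(gaussianReal 0 1) := by
  rw [lintegral_finsetSum _ fun i _ => by fun_prop]
  simp [fun i : Fin n => (measurePreserving_eval_stdGaussian i).lintegral_comp hg]

theorem lintegral_observationLaw {n : ℕ} (μ : EuclideanSpace ℝ (Fin n)) (σ : ℝ)
    {f : EuclideanSpace ℝ (Fin n) → EuclideanSpace ℝ (Fin n)} (hf : Measurable f) :
    ∫⁻ y, ‖f y - μ‖ₑ ^ 2 ∂(observationLaw μ σ)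
      = ∫⁻ z, ‖f (μ + σ • z) - μ‖ₑ ^ 2 ∂(stdGaussian (EuclideanSpace ℝ (Fin n))) := by
  rw [observationLaw, lintegral_map (by fun_prop) (by fun_prop)]

theorem risk_le_worstCaseRisk {n : ℕ} {K : Set (EuclideanSpace ℝ (Fin n))} (σ : ℝ)
    (f : EuclideanSpace ℝ (Fin n) → EuclideanSpace ℝ (Fin n)) {μ : EuclideanSpace ℝ (Fin n)}
    (hμ : μ ∈ K) : ∫⁻ y, ‖f y - μ‖ₑ ^ 2 ∂(observationLaw μ σ) ≤ worstCaseRisk K σ f :=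
  le_iSup₂ (f := fun μ (_ : μ ∈ K) => ∫⁻ y, ‖f y - μ‖ₑ ^ 2 ∂(observationLaw μ σ)) μ hμ

theorem lintegral_gaussianReal_min_sq_one_pos :
    0 < ∫⁻ x, ENNReal.ofReal (min (x ^ 2) 1) ∂(gaussianReal 0 1) := by
  rw [lintegral_pos_iff_support (by fun_prop)]
  have hsupp : (Function.support fun x : ℝ => ENNReal.ofReal (min (x ^ 2) 1)) = {0}ᶜ := by
    ext x
    simp [sq_pos_iff, ← not_lt]
  have : NullSingletonClass (gaussianReal 0 1) := nullSingletonClass_gaussianReal one_ne_zero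
  rw [hsupp, prob_compl_eq_one_sub (measurableSet_singleton 0), measure_singleton]
  simp

theorem lintegral_gaussianReal_min_sq_one_le :
    ∫⁻ x, ENNReal.ofReal (min (x ^ 2) 1) ∂(gaussianReal 0 1) ≤ 1 := by
  calc ∫⁻ x, ENNReal.ofReal (min (x ^ 2) 1) ∂(gaussianReal 0 1)
      ≤ ∫⁻ _, 1 ∂(gaussianReal 0 1) := lintegral_mono fun x => by
        simp
    _ = 1 := by simp

theorem ENNReal.le_rpow_half_of_sq_le {x y : ℝ≥0∞} (h : x ^ 2 ≤ y) : x ≤ y ^ (1 / 2 : ℝ) := by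
  rw [one_div, ENNReal.le_rpow_inv_iff (by norm_num)]
  exact_mod_cast h

theorem ENNReal.rpow_half_le_of_le_sq {x y : ℝ≥0∞} (h : x ≤ y ^ 2) : x ^ (1 / 2 : ℝ) ≤ y := by
  rw [one_div, ENNReal.rpow_inv_le_iff (by norm_num)]
  exact_mod_cast h

/-- The two-point bound is integrated over the common noise with `T² = (1 / n) ∑ min (z i ²) 1`. The
truncation ensures `T ≤ 1`, while `T ≤ ‖z‖ / √n` and the mean of `T²` is a positive constant
independent of `n`. -/
theorem IsStronglyConvexSet.le_worstCaseRisk_lse {n : ℕ} {a k σ : ℝ}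
    {K : Set (EuclideanSpace ℝ (Fin n))} (hn : 1 ≤ n) (ha : 0 < a) (hne : K.Nonempty)
    (hK : IsCompact K) (hk : 0 < k) (h : IsStronglyConvexSet k K)
    (hσ : a * (k * √(n : ℝ))⁻¹ ≤ σ) :
    ENNReal.ofReal ((a / (3 + 2 * a) * Metric.diam K) ^ 2) *
      ∫⁻ x, ENNReal.ofReal (min (x ^ 2) 1) ∂(gaussianReal 0 1) ≤
        4 * worstCaseRisk K σ (lse K) := by
  have hn0 : (0 : ℝ) < n := by exact_mod_cast hn
  have hsn : 0 < √(n : ℝ) := Real.sqrt_pos.2 hn0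
  have hσ0 : 0 < σ := lt_of_lt_of_le (by positivity) hσ
  obtain ⟨⟨ξ, η⟩, ⟨hξ, hη⟩, hmax⟩ := (hK.prod hK).exists_isMaxOn (hne.prod hne)
    (f := fun q : EuclideanSpace ℝ (Fin n) × EuclideanSpace ℝ (Fin n) => dist q.1 q.2)
    (by fun_prop)
  have hd : ‖ξ - η‖ = Metric.diam K := by
    rw [← dist_eq_norm]
    refine le_antisymm (Metric.dist_le_diam_of_mem hK.isBounded hξ hη) ?_
    refine Metric.diam_le_of_forall_dist_le dist_nonneg fun x hx y hy => ?_
    exact isMaxOn_iff.1 hmax (x, y) ⟨hx, hy⟩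
  have hmeas : Measurable (lse K) :=
    (lipschitzWith_lse hK.isClosed hne (h.convex hk.le)).continuous.measurable
  set C := a / (3 + 2 * a) * Metric.diam K with hC
  set g : ℝ → ℝ≥0∞ := fun x => ENNReal.ofReal (C ^ 2 / n) * ENNReal.ofReal (min (x ^ 2) 1) with hg
  have hpt : ∀ z : EuclideanSpace ℝ (Fin n), ∑ i, g (z i) ≤
      2 * ‖lse K (ξ + σ • z) - ξ‖ₑ ^ 2 + 2 * ‖lse K (η + σ • z) - η‖ₑ ^ 2 := by
    intro z
    set G := ∑ i, min ((z i) ^ 2) 1 with hG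
    have hG0 : 0 ≤ G := Finset.sum_nonneg fun i _ => by positivity
    have hGn : G ≤ n := by
      calc G ≤ ∑ _i : Fin n, (1 : ℝ) := Finset.sum_le_sum fun i _ => min_le_right _ _
        _ = n := by simp
    have hGz : G ≤ ‖z‖ ^ 2 := by
      rw [EuclideanSpace.real_norm_sq_eq]
      exact Finset.sum_le_sum fun i _ => min_le_left _ _
    have hT : a * √(G / n) ≤ k * ‖σ • z‖ := by
      rw [norm_smul, Real.norm_eq_abs, abs_of_pos hσ0]
      have h1 : √(G / n) ≤ ‖z‖ / √n := by
        rw [Real.sqrt_div hG0]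
        gcongr
        exact Real.sqrt_le_iff.2 ⟨norm_nonneg _, hGz⟩
      calc a * √(G / n) ≤ a * (‖z‖ / √n) := by gcongr
        _ = k * (a * (k * √(n : ℝ))⁻¹ * ‖z‖) := by field_simp
        _ ≤ k * (σ * ‖z‖) := by gcongr
    have hle := h.lse_error_add_lse_error_ge ha hk hK hξ hη hd (σ • z) (Real.sqrt_nonneg (G / n))
      (Real.sqrt_le_one.2 ((div_le_one hn0).2 hGn)) hT
    rw [← hC] at hle
    set e := ‖lse K (ξ + σ • z) - ξ‖ with he
    set f := ‖lse K (η + σ • z) - η‖ with hf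
    have hC0 : 0 ≤ C * √(G / n) := by
      have := Metric.diam_nonneg (s := K); positivity
    have hreal : C ^ 2 / n * G ≤ 2 * e ^ 2 + 2 * f ^ 2 := by
      have h1 : (C * √(G / n)) ^ 2 ≤ (e + f) ^ 2 := pow_le_pow_left₀ hC0 hle 2
      rw [mul_pow, Real.sq_sqrt (by positivity)] at h1
      have h2 : C ^ 2 / n * G = C ^ 2 * (G / n) := by ring
      nlinarith [sq_nonneg (e - f)]
    have hsum : ∑ i, g (z i) = ENNReal.ofReal (C ^ 2 / n * G) := by
      rw [hg, ← Finset.mul_sum, ENNReal.ofReal_mul (by positivity), hG,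
        ENNReal.ofReal_sum_of_nonneg fun i _ => by positivity]
    rw [hsum]
    refine (ENNReal.ofReal_le_ofReal hreal).trans_eq ?_
    rw [ENNReal.ofReal_add (by positivity) (by positivity), ENNReal.ofReal_mul (by norm_num),
      ENNReal.ofReal_mul (by norm_num), ENNReal.ofReal_pow (norm_nonneg _),
      ENNReal.ofReal_pow (norm_nonneg _), ofReal_norm, ofReal_norm]
    simp
  have hint := lintegral_mono (μ := stdGaussian (EuclideanSpace ℝ (Fin n))) hpt
  rw [lintegral_stdGaussian_sum_eval (by fun_prop), lintegral_add_left (by fun_prop),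
    lintegral_const_mul _ (by fun_prop), lintegral_const_mul _ (by fun_prop),
    lintegral_const_mul _ (by fun_prop),
    ← lintegral_observationLaw ξ σ hmeas, ← lintegral_observationLaw η σ hmeas, ← mul_assoc] at hint
  have hcoef : (n : ℝ≥0∞) * ENNReal.ofReal (C ^ 2 / n) = ENNReal.ofReal (C ^ 2) := by
    rw [← ENNReal.ofReal_natCast, ← ENNReal.ofReal_mul hn0.le]
    congr 1; field_simp
  rw [hcoef] at hint
  refine hint.trans ?_
  calc _ ≤ 2 * worstCaseRisk K σ (lse K) + 2 * worstCaseRisk K σ (lse K) := by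
        gcongr <;> exact risk_le_worstCaseRisk σ _ ‹_›
    _ = 4 * worstCaseRisk K σ (lse K) := by rw [← add_mul]; norm_num

/-- The least squares estimator on a strongly convex body has a rate of the order of the diameter,
once the noise level is at least of the order `(k √n)⁻¹`. -/
theorem exists_mul_diam_le_lseRate {a : ℝ} (ha : 0 < a) : ∃ c : ℝ, 0 < c ∧
    ∀ (n : ℕ) (K : Set (EuclideanSpace ℝ (Fin n))) (k σ : ℝ),
      1 ≤ n → K.Nonempty → IsCompact K → 0 < k → IsStronglyConvexSet k K →
      a * (k * √(n : ℝ))⁻¹ ≤ σ → ENNReal.ofReal (c * Metric.diam K) ≤ lseRate K σ := by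
  set κ := ∫⁻ x, ENNReal.ofReal (min (x ^ 2) 1) ∂(gaussianReal 0 1) with hκ
  have hκ0 : 0 < κ := lintegral_gaussianReal_min_sq_one_pos
  have hκt : κ ≠ ⊤ := (lintegral_gaussianReal_min_sq_one_le.trans_lt ENNReal.one_lt_top).ne
  have hκr : 0 < κ.toReal := ENNReal.toReal_pos hκ0.ne' hκt
  refine ⟨a / (3 + 2 * a) * (√κ.toReal / 2), by positivity, ?_⟩
  intro n K k σ hn hne hK hk h hσ
  have hmain := h.le_worstCaseRisk_lse hn ha hne hK hk hσ
  rw [← hκ, ← ENNReal.ofReal_toReal hκt, ← ENNReal.ofReal_mul (by positivity)] at hmain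
  refine ENNReal.le_rpow_half_of_sq_le ?_
  rw [← ENNReal.mul_le_mul_iff_right (a := 4) (by norm_num) (by norm_num)]
  refine le_trans (le_of_eq ?_) hmain
  have hd := Metric.diam_nonneg (s := K)
  rw [← ENNReal.ofReal_pow (by positivity), ← ENNReal.ofReal_ofNat 4,
    ← ENNReal.ofReal_mul (by norm_num)]
  congr 1
  have hs := Real.sq_sqrt hκr.le
  calc _ = (a / (3 + 2 * a) * Metric.diam K) ^ 2 * √κ.toReal ^ 2 := by ring
    _ = _ := by rw [hs]

/-! ### Hard thresholding and the minimax upper bound. -/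

/-- Hard thresholding at level `τ`. -/
noncomputable def hardThreshold (τ y : ℝ) : ℝ := if |y| ≤ τ then 0 else y

theorem measurable_hardThreshold (τ : ℝ) : Measurable (hardThreshold τ) :=
  Measurable.ite (measurableSet_le (by fun_prop) (by fun_prop)) measurable_const measurable_id

theorem sq_le_rpow_mul_abs_rpow {p e μ t : ℝ} (hp : 0 < p) (hp2 : p < 2)
    (he : |e| ≤ |μ|) (het : |e| ≤ t) : e ^ 2 ≤ t ^ (2 - p) * |μ| ^ p := by
  rcases (abs_nonneg e).eq_or_lt with h0 | h0
  · have : e = 0 := abs_eq_zero.1 h0.symm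
    have ht : 0 ≤ t := (abs_nonneg e).trans het
    rw [this, zero_pow two_ne_zero]; positivity
  · rw [← sq_abs, ← Real.rpow_two, show (2 : ℝ) = (2 - p) + p by ring, Real.rpow_add h0]
    have ht : 0 < t := h0.trans_le het
    have h1 : |e| ^ (2 - p) ≤ t ^ (2 - p) := Real.rpow_le_rpow h0.le het (by linarith)
    have h2 : |e| ^ p ≤ |μ| ^ p := Real.rpow_le_rpow h0.le he hp.le
    have e1 : (2 - p + p - p) = 2 - p := by ring
    rw [e1]
    exact mul_le_mul h1 h2 (by positivity) (by positivity)

/-- If `|w| ≤ τ / 2`, the error is at most both `|μ|` and `2 τ`, and interpolation applies.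
Otherwise it is at most `3 |w|`, and the factor `(2 |w| / τ) ^ m ≥ 1` is inserted for free; `m`
stays open so that a high moment can beat the sum over `n` coordinates. -/
theorem sq_hardThreshold_sub_le {p τ : ℝ} (hp : 0 < p) (hp2 : p < 2) (hτ : 0 < τ) (m : ℕ)
    (μ w : ℝ) : (hardThreshold τ (μ + w) - μ) ^ 2 ≤
      (2 * τ) ^ (2 - p) * |μ| ^ p + 9 * (2 / τ) ^ m * |w| ^ (m + 2) := by
  have htri : |μ| ≤ |μ + w| + |w| := by
    have := abs_sub (μ + w) w
    simpa using this
  have htri2 : |μ + w| ≤ |μ| + |w| := abs_add_le _ _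
  by_cases hw : |w| ≤ τ / 2
  · refine le_add_of_le_of_nonneg ?_ (by positivity)
    apply sq_le_rpow_mul_abs_rpow hp hp2
    · rw [hardThreshold]
      split_ifs with h
      · simp
      · rw [add_sub_cancel_left]; linarith
    · rw [hardThreshold]
      split_ifs with h
      · rw [zero_sub, abs_neg]; linarith
      · rw [add_sub_cancel_left]; linarith
  · refine le_add_of_nonneg_of_le (by positivity) ?_
    push Not at hw
    have h1 : |hardThreshold τ (μ + w) - μ| ≤ 3 * |w| := by
      rw [hardThreshold]
      split_ifs with h
      · rw [zero_sub, abs_neg]; linarith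
      · rw [add_sub_cancel_left]; linarith [abs_nonneg w]
    have h2 : 1 ≤ (2 / τ * |w|) ^ m := by
      refine one_le_pow₀ ?_
      rw [div_mul_eq_mul_div, one_le_div hτ]; linarith
    rw [← sq_abs]
    calc _ ≤ (3 * |w|) ^ 2 := pow_le_pow_left₀ (abs_nonneg _) h1 2
      _ = 9 * |w| ^ 2 * 1 := by ring
      _ ≤ 9 * |w| ^ 2 * (2 / τ * |w|) ^ m := by gcongr
      _ = 9 * (2 / τ) ^ m * |w| ^ (m + 2) := by rw [mul_pow]; ring

theorem lintegral_gaussianReal_abs_pow_ne_top (m : ℕ) :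
    ∫⁻ x, ENNReal.ofReal (|x| ^ m) ∂(gaussianReal 0 1) ≠ ⊤ := by
  have h := (memLp_id_gaussianReal (μ := 0) (v := 1) m).integrable_norm_pow'
  have := h.lintegral_lt_top.ne
  simpa using this

/-- The risk of coordinatewise hard thresholding over the `ℓ_p` ball. -/
theorem minimaxRate_lpUnitBall_le_of_threshold {n : ℕ} {p τ σ : ℝ} (hp : 0 < p) (hp2 : p < 2) (hτ : 0 < τ)
    (hσ : 0 ≤ σ) (m : ℕ) {r : ℝ} (hr : 0 ≤ r)
    (hle : (2 * τ) ^ (2 - p) + 9 * (2 / τ) ^ m * (n * σ ^ (m + 2) *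
      (∫⁻ x, ENNReal.ofReal (|x| ^ (m + 2)) ∂(gaussianReal 0 1)).toReal) ≤ r ^ 2) :
    minimaxRate (lpUnitBall n p) σ ≤ ENNReal.ofReal r := by
  set f : EuclideanSpace ℝ (Fin n) → EuclideanSpace ℝ (Fin n) :=
    fun y => WithLp.toLp 2 fun i => hardThreshold τ (y i) with hf
  have hmeas : Measurable f := by
    refine (WithLp.measurable_toLp 2 _).comp (measurable_pi_lambda _ fun i => ?_)
    exact (measurable_hardThreshold τ).comp (by fun_prop)
  refine ENNReal.rpow_half_le_of_le_sq ((iInf₂_le f hmeas).trans ?_)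
  refine iSup₂_le fun μ hμ => ?_
  rw [lintegral_observationLaw μ σ hmeas]
  set c := 9 * (2 / τ) ^ m * σ ^ (m + 2) with hc
  set g : ℝ → ℝ≥0∞ := fun x => ENNReal.ofReal c * ENNReal.ofReal (|x| ^ (m + 2)) with hg
  have hc0 : 0 ≤ c := by positivity
  have hpt : ∀ z : EuclideanSpace ℝ (Fin n), ‖f (μ + σ • z) - μ‖ₑ ^ 2 ≤
      ENNReal.ofReal ((2 * τ) ^ (2 - p)) + ∑ i, g (z i) := by
    intro z
    have hsum : ∑ i, g (z i) = ENNReal.ofReal (c * ∑ i, |z i| ^ (m + 2)) := by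
      rw [hg, ← Finset.mul_sum, ENNReal.ofReal_mul hc0,
        ENNReal.ofReal_sum_of_nonneg fun i _ => by positivity]
    rw [hsum, ← ENNReal.ofReal_add (by positivity)
      (mul_nonneg hc0 (Finset.sum_nonneg fun i _ => by positivity)), ← ofReal_norm,
      ← ENNReal.ofReal_pow (norm_nonneg _)]
    refine ENNReal.ofReal_le_ofReal ?_
    rw [EuclideanSpace.real_norm_sq_eq]
    have h1 : ∀ i, (f (μ + σ • z) - μ) i ^ 2 ≤
        (2 * τ) ^ (2 - p) * |μ i| ^ p + c * |z i| ^ (m + 2) := by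
      intro i
      have h := sq_hardThreshold_sub_le hp hp2 hτ m (μ i) (σ * z i)
      rw [abs_mul, abs_of_nonneg hσ, mul_pow, ← mul_assoc] at h
      simpa [hf] using h
    refine (Finset.sum_le_sum fun i _ => h1 i).trans ?_
    rw [Finset.sum_add_distrib, ← Finset.mul_sum, ← Finset.mul_sum]
    gcongr
    exact mul_le_of_le_one_right (by positivity) hμ
  have hA := lintegral_gaussianReal_abs_pow_ne_top (m + 2)
  refine (lintegral_mono hpt).trans ?_
  rw [lintegral_add_left (by fun_prop), lintegral_stdGaussian_sum_eval (by fun_prop),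
    lintegral_const_mul _ (by fun_prop), lintegral_const, measure_univ, mul_one,
    ← ENNReal.ofReal_toReal hA, ← ENNReal.ofReal_natCast, ← ENNReal.ofReal_mul hc0,
    ← ENNReal.ofReal_mul (by positivity), ← ENNReal.ofReal_add (by positivity) (by positivity),
    ← ENNReal.ofReal_pow hr]
  refine ENNReal.ofReal_le_ofReal (le_trans (le_of_eq ?_) hle)
  rw [hc]; ring

/-- The minimax rate over the `ℓ_p` ball vanishes at noise levels of the order
`n ^ (-(1 - 1 / p))`. -/
theorem exists_forall_minimaxRate_lpUnitBall_le {p b δ : ℝ} (hp : 1 < p) (hp2 : p < 2)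
    (hb : 0 < b) (hδ : 0 < δ) : ∃ N : ℕ, ∀ (n : ℕ) (σ : ℝ), N ≤ n → 1 ≤ n → 0 ≤ σ →
      σ ≤ b * (n : ℝ) ^ (-(1 - 1 / p)) →
        minimaxRate (lpUnitBall n p) σ ≤ ENNReal.ofReal δ := by
  have hp0 : 0 < p := by linarith
  have hθ : 0 < 1 - 1 / p := by rw [sub_pos, div_lt_one hp0]; exact hp
  set θ := 1 - 1 / p
  -- With `m θ ≥ 2` the noise term `n σ ^ (m + 2)` is `O(1 / n)`. The level `τ` makes the bias term
  -- exactly `δ² / 2`, and `N` brings the noise term below `δ² / 2`.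
  obtain ⟨m, hm⟩ := exists_nat_ge (2 / θ)
  rw [div_le_iff₀ hθ] at hm
  set τ := (δ ^ 2 / 2) ^ (1 / (2 - p)) / 2 with hτ
  have hτ0 : 0 < τ := by positivity
  have hτe : (2 * τ) ^ (2 - p) = δ ^ 2 / 2 := by
    rw [hτ, mul_div_cancel₀ _ two_ne_zero, ← Real.rpow_mul (by positivity),
      one_div_mul_cancel (by linarith), Real.rpow_one]
  set A := (∫⁻ x, ENNReal.ofReal (|x| ^ (m + 2)) ∂(gaussianReal 0 1)).toReal with hA
  have hA0 : 0 ≤ A := ENNReal.toReal_nonneg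
  set B := 9 * (2 / τ) ^ m * (b ^ (m + 2) * A) with hB
  have hB0 : 0 ≤ B := by positivity
  obtain ⟨N, hN⟩ := exists_nat_ge (B / (δ ^ 2 / 2))
  rw [div_le_iff₀ (by positivity)] at hN
  refine ⟨N, fun n σ hNn hn hσ0 hσ => ?_⟩
  have hn1 : (1 : ℝ) ≤ n := by exact_mod_cast hn
  have hn0 : (0 : ℝ) < n := by linarith
  refine minimaxRate_lpUnitBall_le_of_threshold hp0 hp2 hτ0 hσ0 m hδ.le ?_
  rw [hτe, ← hA]
  have h1 : n * σ ^ (m + 2) ≤ b ^ (m + 2) * (n : ℝ)⁻¹ := by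
    calc n * σ ^ (m + 2) ≤ n * (b * (n : ℝ) ^ (-θ)) ^ (m + 2) := by gcongr
      _ = b ^ (m + 2) * (n : ℝ) ^ (1 + -θ * (m + 2 : ℕ)) := by
          rw [mul_pow, Real.rpow_add hn0, Real.rpow_mul hn0.le, Real.rpow_natCast, Real.rpow_one]
          ring
      _ ≤ b ^ (m + 2) * (n : ℝ) ^ (-1 : ℝ) := by
          refine mul_le_mul_of_nonneg_left ?_ (by positivity)
          refine Real.rpow_le_rpow_of_exponent_le hn1 ?_
          push_cast; nlinarith
      _ = b ^ (m + 2) * (n : ℝ)⁻¹ := by rw [Real.rpow_neg_one]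
  have h2 : 9 * (2 / τ) ^ m * (n * σ ^ (m + 2) * A) ≤ δ ^ 2 / 2 := by
    calc 9 * (2 / τ) ^ m * (n * σ ^ (m + 2) * A)
        ≤ 9 * (2 / τ) ^ m * (b ^ (m + 2) * (n : ℝ)⁻¹ * A) := by gcongr
      _ = B / n := by rw [hB]; ring
      _ ≤ δ ^ 2 / 2 := by
          rw [div_le_iff₀ hn0]
          have : (N : ℝ) ≤ n := by exact_mod_cast hNn
          have : (N : ℝ) * (δ ^ 2 / 2) ≤ n * (δ ^ 2 / 2) := by gcongr
          linarith
  linarith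

/-! ### Rates on `ℓ_p` balls and conclusion. -/

theorem lseRate_le_diam {n : ℕ} {K : Set (EuclideanSpace ℝ (Fin n))} (hK : IsCompact K)
    (hne : K.Nonempty) (σ : ℝ) : lseRate K σ ≤ ENNReal.ofReal (Metric.diam K) := by
  refine ENNReal.rpow_half_le_of_le_sq (iSup₂_le fun μ hμ => ?_)
  have : IsProbabilityMeasure (observationLaw μ σ) :=
    Measure.isProbabilityMeasure_map (by fun_prop)
  refine (lintegral_mono (g := fun _ => ENNReal.ofReal (Metric.diam K) ^ 2) fun y => ?_).trans
    (by simp)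
  refine pow_le_pow_left₀ zero_le ?_ 2
  rw [← ofReal_norm, ← dist_eq_norm]
  exact ENNReal.ofReal_le_ofReal
    (Metric.dist_le_diam_of_mem hK.isBounded (lse_spec hK.isClosed hne y).1 hμ)

theorem lseRate_lpUnitBall_le_two {n : ℕ} {p : ℝ} (hp : 0 < p) (hp2 : p ≤ 2) (σ : ℝ) :
    lseRate (lpUnitBall n p) σ ≤ 2 := by
  refine (lseRate_le_diam (isCompact_lpUnitBall hp hp2) ⟨0, zero_mem_lpUnitBall hp⟩ σ).trans ?_
  refine ENNReal.ofReal_le_of_le_toReal (Metric.diam_le_of_forall_dist_le (by simp) fun x hx y hy => ?_)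
  have h1 := norm_le_one_of_mem_lpUnitBall hp hp2 hx
  have h2 := norm_le_one_of_mem_lpUnitBall hp hp2 hy
  rw [dist_eq_norm, ENNReal.toReal_ofNat]
  linarith [norm_sub_le x y]

theorem exists_le_lseRate_lpUnitBall {p a : ℝ} (hp : 1 < p) (hp2 : p < 2) (ha : 0 < a) :
    ∃ c : ℝ, 0 < c ∧ ∀ (n : ℕ) (σ : ℝ), 1 ≤ n → a * (n : ℝ) ^ (-(1 - 1 / p)) ≤ σ →
      ENNReal.ofReal c ≤ lseRate (lpUnitBall n p) σ := by
  have hp0 : 0 < p := by linarith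
  have hp1 : 0 < p - 1 := by linarith
  -- The factor `(p - 1) / 2` cancels the one in `k √n = (p - 1) / 2 * n ^ (1 - 1 / p)`.
  obtain ⟨c, hc, h⟩ := exists_mul_diam_le_lseRate (a := a * ((p - 1) / 2)) (by positivity)
  refine ⟨c * 2, by positivity, fun n σ hn hσ => ?_⟩
  have hn0 : (0 : ℝ) < n := by exact_mod_cast hn
  refine le_trans (ENNReal.ofReal_le_ofReal ?_) (h n (lpUnitBall n p)
    ((p - 1) / 2 * (n : ℝ) ^ (-(1 / p - 1 / 2))) σ hn ⟨0, zero_mem_lpUnitBall hp0⟩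
    (isCompact_lpUnitBall hp0 hp2.le) (by positivity) (isStronglyConvexSet_lpUnitBall hn hp hp2)
    (le_trans (le_of_eq ?_) hσ))
  · exact mul_le_mul_of_nonneg_left (two_le_diam_lpUnitBall hn hp0 hp2.le) hc.le
  · have e : (n : ℝ) ^ (-(1 / p - 1 / 2)) * √(n : ℝ) = ((n : ℝ) ^ (-(1 - 1 / p)))⁻¹ := by
      rw [Real.sqrt_eq_rpow, ← Real.rpow_add hn0, ← Real.rpow_neg hn0.le]
      congr 1; ring
    rw [mul_assoc ((p - 1) / 2), e, mul_inv, inv_inv]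
    field_simp

theorem lemma3p16 :
    -- the rate of the least squares estimator on a strongly convex body
    (∀ a b : ℝ, 0 < a → 0 < b → ∃ c : ℝ, 0 < c ∧
      ∀ (n : ℕ) (K : Set (EuclideanSpace ℝ (Fin n))) (k σ : ℝ),
        1 ≤ n → K.Nonempty → IsCompact K → 0 < k → IsStronglyConvexSet k K →
        a * (k * √(n : ℝ))⁻¹ ≤ σ → σ ≤ b * (k * √(n : ℝ))⁻¹ →
        ENNReal.ofReal (c * Metric.diam K) ≤ lseRate K σ) ∧
    -- suboptimality of the least squares estimator on the unit balls of `ℓ_p` for `1 < p < 2`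
    (∀ p : ℝ, 1 < p → p < 2 → ∀ a b : ℝ, 0 < a → 0 < b →
      (∃ c : ℝ, 0 < c ∧ ∀ (n : ℕ) (σ : ℝ), 1 ≤ n →
        a * (n : ℝ) ^ (-(1 - 1 / p)) ≤ σ → σ ≤ b * (n : ℝ) ^ (-(1 - 1 / p)) →
        ENNReal.ofReal c ≤ lseRate (lpUnitBall n p) σ ∧ lseRate (lpUnitBall n p) σ ≤ 2) ∧
      (∀ δ : ℝ, 0 < δ → ∃ N : ℕ, ∀ (n : ℕ) (σ : ℝ), N ≤ n → 1 ≤ n →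
        a * (n : ℝ) ^ (-(1 - 1 / p)) ≤ σ → σ ≤ b * (n : ℝ) ^ (-(1 - 1 / p)) →
        minimaxRate (lpUnitBall n p) σ ≤ ENNReal.ofReal δ ∧
        minimaxRate (lpUnitBall n p) σ ≤ ENNReal.ofReal δ * lseRate (lpUnitBall n p) σ)) := by
  refine ⟨fun a b ha _ => ?_, fun p hp hp2 a b ha hb => ?_⟩
  · obtain ⟨c, hc, h⟩ := exists_mul_diam_le_lseRate ha
    exact ⟨c, hc, fun n K k σ hn hne hK hk hs hσ _ => h n K k σ hn hne hK hk hs hσ⟩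
  have hp0 : 0 < p := by linarith
  obtain ⟨c, hc, h⟩ := exists_le_lseRate_lpUnitBall hp hp2 ha
  refine ⟨⟨c, hc, fun n σ hn hσ _ => ⟨h n σ hn hσ, lseRate_lpUnitBall_le_two hp0 hp2.le σ⟩⟩,
    fun δ hδ => ?_⟩
  obtain ⟨N₁, h₁⟩ := exists_forall_minimaxRate_lpUnitBall_le hp hp2 hb hδ
  -- As the least squares rate is at least `c`, accuracy `δ c` gives the relative bound.
  obtain ⟨N₂, h₂⟩ := exists_forall_minimaxRate_lpUnitBall_le hp hp2 hb (mul_pos hδ hc)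
  refine ⟨max N₁ N₂, fun n σ hN hn hσ hσb => ?_⟩
  have hσ0 : 0 ≤ σ := le_trans (by positivity) hσ
  refine ⟨h₁ n σ (le_trans (le_max_left _ _) hN) hn hσ0 hσb,
    (h₂ n σ (le_trans (le_max_right _ _) hN) hn hσ0 hσb).trans ?_⟩
  rw [ENNReal.ofReal_mul hδ.le]
  gcongr
  exact h n σ hn hσ
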